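/- Let $X$ and $\Omega$ be locally compact Hausdorff spaces with their Borel $\sigma$-algebras, let $\phi\in C_0(X\times\Omega)$ be real-valued, and let $(\mathcal U,\mathcal U^\diamond)$ be a dual pair of real Banach spaces with a continuous pairing, that is, a continuous bilinear map $\langle\cdot,\cdot\rangle_{\mathcal U}:\mathcal U^\diamond\times\mathcal U\to\mathbb R$ that is nondegenerate in both arguments. For a Banach space $\mathcal V$, let $\mathcal M(\Omega;\mathcal V)$ be the space of countably additive $\mathcal V$-valued Borel measures on $\Omega$ whose total variation is finite and regular, and similarly for $X$. For $\mu\in\mathcal M(\Omega;\mathcal U)$ and $\rho\in\mathcal M(X;\mathcal U^\diamond)$ put $$(A_{\Omega\to X}\mu)(x)=\int_\Omega\phi(x,w)\,d\mu(w)\in\mathcal U,\qquad (A_{X\to\Omega}\rho)(w)=\int_X\phi(x,w)\,d\rho(x)\in\mathcal U^\diamond,$$ and let $\mathcal B=\{A_{\Omega\to X}\mu\}$ and $\mathcal B^\diamond=\{A_{X\to\Omega}\rho\}$ be the resulting function spaces. Let $\langle\rho,\mu\rangle_{\mathcal U}$ be the unique signed measure on the product $\sigma$-algebra of $X\times\Omega$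 with $\langle\rho,\mu\rangle_{\mathcal U}(E\times F)=\langle\rho(E),\mu(F)\rangle_{\mathcal U}$ for all Borel sets $E\subseteq X$, $F\subseteq\Omega$; it has finite total variation. For $f\in\mathcal B$ and $g\in\mathcal B^\diamond$ define $\langle g,f\rangle_{\mathcal B}=\int_{X\times\Omega}\phi\,d\langle\rho,\mu\rangle_{\mathcal U}$, computed with some choice of representing measures $f=A_{\Omega\to X}\mu$, $g=A_{X\to\Omega}\rho$. For a measurable simple function $g=\sum_j u_j^\diamond\mathbf 1_{B_j}:\Omega\to\mathcal U^\diamond$ with disjoint $B_j$, set $\langle\mu,g\rangle_{C_0(\Omega;\mathcal U^\diamond)}=\sum_j\langle u_j^\diamond,\mu(B_j)\rangle_{\mathcal U}$, and extend $\langle\mu,\cdot\rangle_{C_0(\Omega;\mathcal U^\diamond)}$ continuously, for the supremum norm, to all uniform limits of simple functions. Define $\langle\rho,f\rangle_{C_0(X;\mathcal U)}$ for uniform limits $f:X\to\mathcal U$ of simple functions in the same way. **Theorem (the pairing is well defined).** Let $\mu\in\mathcal M(\Omega;\mathcal U)$, $\rho\in\mathcal M(X;\mathcal U^\diamond)$,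 $f=A_{\Omega\to X}\mu$ and $g=A_{X\to\Omega}\rho$. Then $f$ and $g$ are uniform limits of simple functions, $\phi$ is integrable with respect to $\langle\rho,\mu\rangle_{\mathcal U}$, and $$\langle g,f\rangle_{\mathcal B}=\int_{X\times\Omega}\phi\,d\langle\rho,\mu\rangle_{\mathcal U}=\langle\mu,g\rangle_{C_0(\Omega;\mathcal U^\diamond)}=\langle\rho,f\rangle_{C_0(X;\mathcal U)}.$$ In particular, the pairing does not depend on the representing measures: if also $f=A_{\Omega\to X}\mu'$ and $g=A_{X\to\Omega}\rho'$ with $\mu'\in\mathcal M(\Omega;\mathcal U)$, $\rho'\in\mathcal M(X;\mathcal U^\diamond)$, then $\int\phi\,d\langle\rho,\mu\rangle_{\mathcal U}=\int\phi\,d\langle\rho',\mu'\rangle_{\mathcal U}$. -/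

import Mathlib

open MeasureTheory Filter Topology
open scoped ZeroAtInfty

set_option linter.unusedSectionVars false

/-- A continuous bilinear map `B : V × U → ℝ` is a dual pairing when it is nondegenerate in both
arguments. -/
def IsDualPairing {U V : Type*} [NormedAddCommGroup U] [NormedSpace ℝ U]
    [NormedAddCommGroup V] [NormedSpace ℝ V] (B : V →L[ℝ] U →L[ℝ] ℝ) : Prop :=
  (∀ u : U, (∀ v : V, B v u = 0) → u = 0) ∧ (∀ v : V, (∀ u : U, B v u = 0) → v = 0)

/-- The space `M(Ω; U)` of countably additive `U`-valued measures of finite total variation whose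
total variation measure is regular. -/
abbrev RegularVectorMeasure (Ω U : Type*) [TopologicalSpace Ω] [MeasurableSpace Ω]
    [NormedAddCommGroup U] : Type _ :=
  {μ : VectorMeasure Ω U // IsFiniteMeasure μ.variation ∧ μ.variation.Regular}

instance {Ω U : Type*} [TopologicalSpace Ω] [MeasurableSpace Ω] [NormedAddCommGroup U]
    (μ : RegularVectorMeasure Ω U) : IsFiniteMeasure μ.1.variation := μ.2.1

section Pairing

variable {Ω E F : Type*} [MeasurableSpace Ω]
  [NormedAddCommGroup E] [NormedSpace ℝ E] [NormedAddCommGroup F] [NormedSpace ℝ F]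

/-- The pairing of a vector measure `μ` with a simple function `g = ∑ u, u 𝟙_{g = u}`, namely
`∑ u, B(u, μ(g = u))`. -/
noncomputable def simplePairing (B : E →L[ℝ] F →L[ℝ] ℝ) (μ : VectorMeasure Ω F)
    (g : SimpleFunc Ω E) : ℝ :=
  ∑ u ∈ g.range, B u (μ (g ⁻¹' {u}))

/-- The functions that are uniform limits of simple functions. -/
def IsUniformLimitOfSimple (g : Ω → E) : Prop :=
  ∀ ε : ℝ, 0 < ε → ∃ s : SimpleFunc Ω E, ∀ w, ‖s w - g w‖ ≤ ε

/-- The filter describing "the simple function `s` tends to `g` uniformly". -/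
def simpleNhds (g : Ω → E) : Filter (SimpleFunc Ω E) :=
  ⨅ (ε : ℝ) (_ : 0 < ε), 𝓟 {s | ∀ w, ‖s w - g w‖ ≤ ε}

/-- The continuous extension of `simplePairing B μ` to uniform limits `g` of simple functions:
the limit of `simplePairing B μ s` as the simple function `s` tends to `g` uniformly. -/
noncomputable def uniformPairing (B : E →L[ℝ] F →L[ℝ] ℝ) (μ : VectorMeasure Ω F)
    (g : Ω → E) : ℝ :=
  limUnder (simpleNhds g) (simplePairing B μ)


theorem simpleNhds_hasBasis (g : Ω → E) :
    (simpleNhds g).HasBasis (fun ε : ℝ ↦ 0 < ε) fun ε ↦ {s | ∀ w, ‖s w - g w‖ ≤ ε} := by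
  refine hasBasis_biInf_principal' (fun ε hε δ hδ ↦ ?_) ⟨1, one_pos⟩
  exact ⟨min ε δ, lt_min hε hδ, fun s hs w ↦ (hs w).trans (min_le_left _ _),
    fun s hs w ↦ (hs w).trans (min_le_right _ _)⟩


theorem simpleNhds_neBot {g : Ω → E} (hg : IsUniformLimitOfSimple g) : (simpleNhds g).NeBot :=
  (simpleNhds_hasBasis g).neBot_iff.2 fun {ε} hε ↦ hg ε hε

theorem simplePairing_eq_integral (B : E →L[ℝ] F →L[ℝ] ℝ) (μ : VectorMeasure Ω F)
    [IsFiniteMeasure μ.variation] (s : SimpleFunc Ω E) :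
    simplePairing B μ s = μ.integral s B := by
  classical
  have h : (s : Ω → E) = fun w ↦ ∑ u ∈ s.range, (s ⁻¹' {u}).indicator (fun _ ↦ u) w := by
    funext w
    rw [Finset.sum_eq_single (s w)]
    · simp
    · intro u _ hu
      exact Set.indicator_of_notMem (fun hw ↦ hu (by simpa using hw.symm)) _
    · intro hw
      exact absurd (s.mem_range_self w) hw
  rw [h, VectorMeasure.integral_finsetSum]
  · refine Finset.sum_congr rfl fun u _ ↦ ?_
    rw [VectorMeasure.integral_indicator_const _ (s.measurableSet_fiber u)]
  · intro u _
    exact (integrable_const u).indicator (s.measurableSet_fiber u)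

theorem IsUniformLimitOfSimple.integrable {g : Ω → E} (hg : IsUniformLimitOfSimple g)
    (m : Measure Ω) [IsFiniteMeasure m] : Integrable g m := by
  choose! t ht using hg
  have hm : StronglyMeasurable g := by
    refine ⟨fun n ↦ t (1 / ((n : ℝ) + 1)), fun w ↦ ?_⟩
    rw [tendsto_iff_norm_sub_tendsto_zero]
    exact squeeze_zero (fun _ ↦ norm_nonneg _) (fun n ↦ ht _ (by positivity) w)
      tendsto_one_div_add_atTop_nhds_zero_nat
  have h1 : Integrable (fun w ↦ t 1 w - g w) m :=
    Integrable.of_bound ((t 1).stronglyMeasurable.sub hm).aestronglyMeasurable 1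
      (Eventually.of_forall (ht 1 one_pos))
  refine (((t 1).integrable_of_isFiniteMeasure (μ := m)).sub h1).congr (Eventually.of_forall ?_)
  intro w
  simp

theorem tendsto_simplePairing_integral (B : E →L[ℝ] F →L[ℝ] ℝ) (μ : VectorMeasure Ω F)
    [IsFiniteMeasure μ.variation] {g : Ω → E} (hg : IsUniformLimitOfSimple g) :
    Tendsto (simplePairing B μ) (simpleNhds g) (𝓝 (μ.integral g B)) := by
  rw [(simpleNhds_hasBasis g).tendsto_iff Metric.nhds_basis_ball]
  intro ε hε
  have hK : 0 < ‖B‖ * μ.variation.real Set.univ + 1 := by positivity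
  refine ⟨ε / (‖B‖ * μ.variation.real Set.univ + 1), div_pos hε hK, fun s hs ↦ ?_⟩
  rw [Metric.mem_ball, dist_eq_norm, simplePairing_eq_integral,
    ← VectorMeasure.integral_sub s.integrable_of_isFiniteMeasure (hg.integrable _)]
  have h1 : ∫ w, ‖(s - g : Ω → E) w‖ ∂μ.variation ≤
      ε / (‖B‖ * μ.variation.real Set.univ + 1) * μ.variation.real Set.univ := by
    refine (integral_mono_of_nonneg (Eventually.of_forall fun _ ↦ norm_nonneg _)
      (integrable_const (ε / (‖B‖ * μ.variation.real Set.univ + 1)))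
      (Eventually.of_forall hs)).trans ?_
    simp [mul_comm]
  calc _ ≤ ‖B‖ * ∫ w, ‖(s - g : Ω → E) w‖ ∂μ.variation := VectorMeasure.norm_integral_le_integral_norm
    _ ≤ ‖B‖ * (ε / (‖B‖ * μ.variation.real Set.univ + 1) * μ.variation.real Set.univ) := by gcongr
    _ = ε * (‖B‖ * μ.variation.real Set.univ / (‖B‖ * μ.variation.real Set.univ + 1)) := by ring
    _ < ε * 1 := by
      gcongr
      rw [div_lt_one hK]
      exact lt_add_one _
    _ = ε := mul_one ε

/-- On uniform limits of simple functions, the limit that defines `uniformPairing` exists, so that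
`uniformPairing` is the continuous extension of `simplePairing`. -/
theorem tendsto_simplePairing (B : E →L[ℝ] F →L[ℝ] ℝ) (μ : VectorMeasure Ω F)
    [IsFiniteMeasure μ.variation] {g : Ω → E} (hg : IsUniformLimitOfSimple g) :
    Tendsto (simplePairing B μ) (simpleNhds g) (𝓝 (uniformPairing B μ g)) :=
  tendsto_nhds_limUnder ⟨_, tendsto_simplePairing_integral B μ hg⟩

end Pairing

section IntegralRKBS

variable {X Ω U V : Type*}
  [TopologicalSpace X] [MeasurableSpace X] [TopologicalSpace Ω] [MeasurableSpace Ω]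
  [NormedAddCommGroup U] [NormedSpace ℝ U] [NormedAddCommGroup V] [NormedSpace ℝ V]

/-- `(A_{Ω → X} μ)(x) = ∫ φ(x, w) dμ(w)`. -/
noncomputable def integrateWeights (φ : C₀(X × Ω, ℝ)) (μ : RegularVectorMeasure Ω U) : X → U :=
  fun x ↦ ∫ᵛ w, φ (x, w) ∂•μ.1

/-- `(A_{X → Ω} ρ)(w) = ∫ φ(x, w) dρ(x)`. -/
noncomputable def integrateInputs (φ : C₀(X × Ω, ℝ)) (ρ : RegularVectorMeasure X V) : Ω → V :=
  fun w ↦ ∫ᵛ x, φ (x, w) ∂•ρ.1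

/-- The integrals that define `integrateWeights` exist. -/
theorem integrable_section_left [BorelSpace Ω] (φ : C₀(X × Ω, ℝ)) (μ : RegularVectorMeasure Ω U)
    (x : X) : μ.1.Integrable fun w ↦ φ (x, w) :=
  Integrable.of_bound (by fun_prop : Continuous fun w ↦ φ (x, w)).aestronglyMeasurable ‖φ.toBCF‖
    (Eventually.of_forall fun w ↦ φ.toBCF.norm_coe_le_norm (x, w))

/-- The integrals that define `integrateInputs` exist. -/
theorem integrable_section_right [BorelSpace X] (φ : C₀(X × Ω, ℝ)) (ρ : RegularVectorMeasure X V)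
    (w : Ω) : ρ.1.Integrable fun x ↦ φ (x, w) :=
  Integrable.of_bound (by fun_prop : Continuous fun x ↦ φ (x, w)).aestronglyMeasurable ‖φ.toBCF‖
    (Eventually.of_forall fun x ↦ φ.toBCF.norm_coe_le_norm (x, w))

/-- The functions in the integral RKBS `𝓑`. -/
def integralRKBS (φ : C₀(X × Ω, ℝ)) (U : Type*) [NormedAddCommGroup U] [NormedSpace ℝ U] :
    Set (X → U) :=
  Set.range (integrateWeights (U := U) φ)

/-- The functions in the adjoint integral RKBS `𝓑^◇`. -/
def adjointIntegralRKBS (φ : C₀(X × Ω, ℝ)) (V : Type*) [NormedAddCommGroup V] [NormedSpace ℝ V] :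
    Set (Ω → V) :=
  Set.range (integrateInputs (V := V) φ)

/-- The scalar measure `⟨ρ, μ⟩` on the product `σ`-algebra of `X × Ω`
with `⟨ρ, μ⟩(S × T) = B(ρ(S), μ(T))`. -/
noncomputable def braket (B : V →L[ℝ] U →L[ℝ] ℝ) (ρ : RegularVectorMeasure X V)
    (μ : RegularVectorMeasure Ω U) : SignedMeasure (X × Ω) :=
  ρ.1.prod μ.1 B

/-- `braket B ρ μ` is the unique measure with the prescribed values on measurable rectangles. -/
theorem braket_eq_iff (B : V →L[ℝ] U →L[ℝ] ℝ) (ρ : RegularVectorMeasure X V)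
    (μ : RegularVectorMeasure Ω U) (ν : SignedMeasure (X × Ω)) :
    braket B ρ μ = ν ↔ ∀ (S : Set X) (T : Set Ω), MeasurableSet S → MeasurableSet T →
      ν (S ×ˢ T) = B (ρ.1 S) (μ.1 T) := by
  constructor
  · rintro rfl S T _ _
    exact VectorMeasure.prod_apply
  · exact VectorMeasure.prod_eq_of_forall_apply_prod

/-- The total variation of `⟨ρ, μ⟩` is finite. -/
instance (B : V →L[ℝ] U →L[ℝ] ℝ) (ρ : RegularVectorMeasure X V)
    (μ : RegularVectorMeasure Ω U) : IsFiniteMeasure (braket B ρ μ).variation :=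
  inferInstanceAs (IsFiniteMeasure (ρ.1.prod μ.1 B).variation)

/-- `∫ φ d⟨ρ, μ⟩`. -/
noncomputable def braketIntegral (B : V →L[ℝ] U →L[ℝ] ℝ) (φ : C₀(X × Ω, ℝ))
    (ρ : RegularVectorMeasure X V) (μ : RegularVectorMeasure Ω U) : ℝ :=
  ∫ᵛ z, φ z ∂•(braket B ρ μ)

/-- The pairing `⟨g, f⟩_𝓑 = ∫ φ d⟨ρ, μ⟩`, computed with some choice of representing measures
`f = A_{Ω → X} μ` and `g = A_{X → Ω} ρ`. -/
noncomputable def rkbsPairing (B : V →L[ℝ] U →L[ℝ] ℝ) (φ : C₀(X × Ω, ℝ))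
    (g : adjointIntegralRKBS φ V) (f : integralRKBS φ U) : ℝ :=
  braketIntegral B φ g.2.choose f.2.choose

end IntegralRKBS

/-- The real functions on a product that are uniform limits of functions of
the form `(x, w) ↦ c (p x) (q w)`, where `p` and `q` are simple functions. -/
def IsUniformLimitOfRectangles {X Ω : Type*} [MeasurableSpace X] [MeasurableSpace Ω]
    (φ : X × Ω → ℝ) : Prop :=
  ∀ ε : ℝ, 0 < ε → ∃ (n : ℕ) (p : SimpleFunc X (Fin n)) (q : SimpleFunc Ω (Fin n))
    (c : Fin n → Fin n → ℝ), ∀ x w, ‖φ (x, w) - c (p x) (q w)‖ ≤ ε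

/-- The simple function that records to which of finitely many measurable sets a point belongs. -/
theorem exists_simpleFunc_mem_iff {X ι : Type*} [MeasurableSpace X] [Finite ι] {s : ι → Set X}
    (hs : ∀ i, MeasurableSet (s i)) :
    ∃ p : SimpleFunc X (ι → Prop), ∀ x i, p x i ↔ x ∈ s i := by
  have hm : Measurable fun (x : X) (i : ι) ↦ x ∈ s i :=
    measurable_pi_iff.2 fun i ↦ measurableSet_setOfPred.1 (hs i)
  exact ⟨⟨fun x i ↦ x ∈ s i, fun a ↦ hm (measurableSet_singleton a), Set.toFinite _⟩,
    fun x i ↦ Iff.rfl⟩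

/-- A function in `C₀(X × Ω)` is a uniform limit of step functions on measurable rectangles. -/
theorem ZeroAtInftyContinuousMap.isUniformLimitOfRectangles {X Ω : Type*}
    [TopologicalSpace X] [MeasurableSpace X] [OpensMeasurableSpace X]
    [TopologicalSpace Ω] [MeasurableSpace Ω] [OpensMeasurableSpace Ω] (φ : C₀(X × Ω, ℝ)) :
    IsUniformLimitOfRectangles φ := by
  classical
  intro ε hε
  obtain ⟨K, hK, hKφ⟩ : ∃ K : Set (X × Ω), IsCompact K ∧ ∀ z, z ∉ K → ‖φ z‖ ≤ ε := by
    have h := φ.zero_at_infty' (Metric.closedBall_mem_nhds (0 : ℝ) hε)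
    obtain ⟨K, hK, hKs⟩ := mem_cocompact.1 h
    exact ⟨K, hK, fun z hz ↦ by simpa using hKs hz⟩
  have hloc : ∀ z : X × Ω, ∃ (S : Set X) (T : Set Ω), IsOpen S ∧ IsOpen T ∧ z.1 ∈ S ∧ z.2 ∈ T ∧
      ∀ x ∈ S, ∀ w ∈ T, ‖φ (x, w) - φ z‖ ≤ ε := by
    intro z
    have h : {y | ‖φ y - φ z‖ < ε} ∈ 𝓝 (z.1, z.2) :=
      (isOpen_lt (by fun_prop) continuous_const).mem_nhds (by simpa using hε)
    obtain ⟨S, T, hS, hzS, hT, hzT, hST⟩ := mem_nhds_prod_iff'.1 h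
    exact ⟨S, T, hS, hT, hzS, hzT, fun x hx w hw ↦ (hST (Set.mk_mem_prod hx hw)).le⟩
  choose S T hS hT hzS hzT hST using hloc
  obtain ⟨t, ht⟩ := hK.elim_finite_subcover (fun z ↦ S z ×ˢ T z) (fun z ↦ (hS z).prod (hT z))
    fun z _ ↦ Set.mem_iUnion.2 ⟨z, hzS z, hzT z⟩
  obtain ⟨p, hp⟩ := exists_simpleFunc_mem_iff fun i : t ↦ (hS i).measurableSet
  obtain ⟨q, hq⟩ := exists_simpleFunc_mem_iff fun i : t ↦ (hT i).measurableSet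
  obtain ⟨n, ⟨e⟩⟩ := Finite.exists_equiv_fin (t → Prop)
  refine ⟨n, p.map e, q.map e, fun a b ↦
    if h : ∃ i : t, e.symm a i ∧ e.symm b i then φ h.choose else 0, fun x w ↦ ?_⟩
  simp only [SimpleFunc.map_apply, Equiv.symm_apply_apply]
  split_ifs with h
  · have hi := h.choose_spec
    exact hST _ _ ((hp _ _).1 hi.1) _ ((hq _ _).1 hi.2)
  · rw [sub_zero]
    refine hKφ _ fun hz ↦ h ?_
    obtain ⟨z, hzt, hz⟩ := Set.mem_iUnion₂.1 (ht hz)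
    exact ⟨⟨z, hzt⟩, (hp _ _).2 hz.1, (hq _ _).2 hz.2⟩

theorem IsUniformLimitOfRectangles.isUniformLimitOfSimple {X Ω : Type*} [MeasurableSpace X]
    [MeasurableSpace Ω] {φ : X × Ω → ℝ} (hφ : IsUniformLimitOfRectangles φ) :
    IsUniformLimitOfSimple φ := by
  intro ε hε
  obtain ⟨n, p, q, c, hc⟩ := hφ ε hε
  refine ⟨((p.comp Prod.fst measurable_fst).pair (q.comp Prod.snd measurable_snd)).map
    fun a ↦ c a.1 a.2, fun z ↦ ?_⟩
  rw [norm_sub_rev]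
  exact hc z.1 z.2

section VectorIntegral

variable {X Ω E F G U V : Type*} [MeasurableSpace X] [MeasurableSpace Ω]
  [NormedAddCommGroup E] [NormedSpace ℝ E] [NormedAddCommGroup F] [NormedSpace ℝ F]
  [NormedAddCommGroup G] [NormedSpace ℝ G] [CompleteSpace G]
  [NormedAddCommGroup U] [NormedSpace ℝ U] [NormedAddCommGroup V] [NormedSpace ℝ V]

/-- The integral of a function of a simple function with values in a finite type. -/
theorem integral_comp_simpleFunc {α : Type*} [Fintype α] (B : E →L[ℝ] F →L[ℝ] G)
    (μ : VectorMeasure Ω F) [IsFiniteMeasure μ.variation] (p : SimpleFunc Ω α) (k : α → E) :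
    μ.integral (fun w ↦ k (p w)) B = ∑ a, B (k a) (μ (p ⁻¹' {a})) := by
  classical
  have h : (fun w ↦ k (p w)) = fun w ↦ ∑ a, (p ⁻¹' {a}).indicator (fun _ ↦ k a) w := by
    funext w
    rw [Finset.sum_eq_single (p w) (fun a _ ha ↦ Set.indicator_of_notMem (fun hw ↦ ha hw.symm) _)
      (fun hw ↦ absurd (Finset.mem_univ _) hw)]
    simp
  rw [h, VectorMeasure.integral_finsetSum _ fun a _ ↦
    (integrable_const (k a)).indicator (p.measurableSet_fiber a)]
  exact Finset.sum_congr rfl fun a _ ↦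
    VectorMeasure.integral_indicator_const _ (p.measurableSet_fiber a)

/-- Integrals of uniformly close functions are close. -/
theorem norm_integral_sub_integral_le (B : E →L[ℝ] F →L[ℝ] G) (μ : VectorMeasure Ω F)
    [IsFiniteMeasure μ.variation] {f g : Ω → E} (hf : μ.Integrable f) (hg : μ.Integrable g)
    {ε : ℝ} (h : ∀ w, ‖f w - g w‖ ≤ ε) :
    ‖μ.integral f B - μ.integral g B‖ ≤ ε * ‖B‖ * μ.variation.real Set.univ := by
  rw [← VectorMeasure.integral_sub hf hg]
  exact VectorMeasure.norm_integral_le_of_norm_le_const (Eventually.of_forall h)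

theorem integrable_comp_simpleFunc {α : Type*} [Finite α] (μ : VectorMeasure Ω F)
    [IsFiniteMeasure μ.variation] (p : SimpleFunc Ω α) (k : α → E) :
    μ.Integrable fun w ↦ k (p w) :=
  (p.map k).integrable_of_isFiniteMeasure

theorem uniformPairing_eq_integral (B : E →L[ℝ] F →L[ℝ] ℝ) (μ : VectorMeasure Ω F)
    [IsFiniteMeasure μ.variation] {g : Ω → E} (hg : IsUniformLimitOfSimple g) :
    uniformPairing B μ g = μ.integral g B :=
  haveI := simpleNhds_neBot hg
  tendsto_nhds_unique (tendsto_simplePairing B μ hg) (tendsto_simplePairing_integral B μ hg)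

theorem IsUniformLimitOfSimple.comp_measurable {g : Ω → E} (hg : IsUniformLimitOfSimple g)
    {u : X → Ω} (hu : Measurable u) : IsUniformLimitOfSimple fun x ↦ g (u x) := fun ε hε ↦
  let ⟨s, hs⟩ := hg ε hε
  ⟨s.comp u hu, fun x ↦ hs (u x)⟩

theorem IsUniformLimitOfRectangles.swap {φ : X × Ω → ℝ} (hφ : IsUniformLimitOfRectangles φ) :
    IsUniformLimitOfRectangles fun z : Ω × X ↦ φ z.swap := fun ε hε ↦
  let ⟨n, p, q, c, hc⟩ := hφ ε hε
  ⟨n, q, p, fun a b ↦ c b a, fun w x ↦ hc x w⟩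

/-- If `φ` is close to a step function, then so are its partial integrals. -/
theorem IsUniformLimitOfRectangles.norm_integral_left_sub_le [CompleteSpace V] {φ : X × Ω → ℝ}
    (hφ : IsUniformLimitOfRectangles φ) (ρ : VectorMeasure X V) [IsFiniteMeasure ρ.variation]
    {n : ℕ} {p : SimpleFunc X (Fin n)} {q : SimpleFunc Ω (Fin n)} {c : Fin n → Fin n → ℝ} {ε : ℝ}
    (hc : ∀ x w, ‖φ (x, w) - c (p x) (q w)‖ ≤ ε) (w : Ω) :
    ‖(∫ᵛ x, φ (x, w) ∂•ρ) - ∑ a, c a (q w) • ρ (p ⁻¹' {a})‖ ≤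
      ε * ‖ContinuousLinearMap.lsmul ℝ ℝ (E := V)‖ * ρ.variation.real Set.univ := by
  have h := integral_comp_simpleFunc (ContinuousLinearMap.lsmul ℝ ℝ (E := V)) ρ p
    fun a ↦ c a (q w)
  simp only [ContinuousLinearMap.lsmul_apply] at h
  rw [← h]
  have hφw : ρ.Integrable fun x ↦ φ (x, w) :=
    (hφ.isUniformLimitOfSimple.comp_measurable measurable_prodMk_right).integrable _
  exact norm_integral_sub_integral_le (ContinuousLinearMap.lsmul ℝ ℝ) ρ hφw
    (integrable_comp_simpleFunc ρ p fun a ↦ c a (q w)) fun x ↦ hc x w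

/-- Partial integrals of uniform limits of step functions are uniform limits of simple functions. -/
theorem IsUniformLimitOfRectangles.isUniformLimitOfSimple_integral_left [CompleteSpace V]
    {φ : X × Ω → ℝ} (hφ : IsUniformLimitOfRectangles φ) (ρ : VectorMeasure X V)
    [IsFiniteMeasure ρ.variation] :
    IsUniformLimitOfSimple fun w ↦ ∫ᵛ x, φ (x, w) ∂•ρ := by
  intro ε hε
  set K := ‖ContinuousLinearMap.lsmul ℝ ℝ (E := V)‖ * ρ.variation.real Set.univ with hK
  have hK0 : 0 ≤ K := by positivity
  obtain ⟨n, p, q, c, hc⟩ := hφ (ε / (K + 1)) (by positivity)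
  refine ⟨q.map fun b ↦ ∑ a, c a b • ρ (p ⁻¹' {a}), fun w ↦ ?_⟩
  rw [norm_sub_rev]
  refine (hφ.norm_integral_left_sub_le ρ hc w).trans ?_
  rw [mul_assoc, ← hK, div_mul_eq_mul_div, div_le_iff₀ (by positivity)]
  nlinarith

/-- Fubini's theorem for the product of vector measures. -/
theorem IsUniformLimitOfRectangles.integral_prod [CompleteSpace V] {φ : X × Ω → ℝ}
    (hφ : IsUniformLimitOfRectangles φ) (B : V →L[ℝ] U →L[ℝ] G)
    (ρ : VectorMeasure X V) [IsFiniteMeasure ρ.variation]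
    (μ : VectorMeasure Ω U) [IsFiniteMeasure μ.variation] :
    ∫ᵛ z, φ z ∂•(ρ.prod μ B) = μ.integral (fun w ↦ ∫ᵛ x, φ (x, w) ∂•ρ) B := by
  set C₁ := ‖ContinuousLinearMap.lsmul ℝ ℝ (E := G)‖ * (ρ.prod μ B).variation.real Set.univ
  set C₂ := ‖ContinuousLinearMap.lsmul ℝ ℝ (E := V)‖ * ρ.variation.real Set.univ * ‖B‖ *
    μ.variation.real Set.univ
  have hC : 0 ≤ C₁ + C₂ := by positivity
  refine eq_of_forall_dist_le fun δ hδ ↦ ?_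
  obtain ⟨n, p, q, c, hc⟩ := hφ (δ / (C₁ + C₂ + 1)) (by positivity)
  set ε := δ / (C₁ + C₂ + 1) with hε
  set r := (p.comp Prod.fst measurable_fst).pair (q.comp Prod.snd (measurable_snd (α := X)))
  have h₁ := norm_integral_sub_integral_le (ContinuousLinearMap.lsmul ℝ ℝ (E := G)) (ρ.prod μ B)
    (hφ.isUniformLimitOfSimple.integrable _)
    (integrable_comp_simpleFunc _ r fun a ↦ c a.1 a.2) (fun z ↦ hc z.1 z.2)
  have h₂ := norm_integral_sub_integral_le B μ
    ((hφ.isUniformLimitOfSimple_integral_left ρ).integrable _)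
    (integrable_comp_simpleFunc μ q fun b ↦ ∑ a, c a b • ρ (p ⁻¹' {a}))
    (hφ.norm_integral_left_sub_le ρ hc)
  have hr (a b : Fin n) : r ⁻¹' {(a, b)} = (p ⁻¹' {a}) ×ˢ (q ⁻¹' {b}) := by
    ext z
    simp [r]
  have h : (ρ.prod μ B).integral (fun z ↦ c (r z).1 (r z).2)
      (ContinuousLinearMap.lsmul ℝ ℝ (E := G)) =
      μ.integral (fun w ↦ ∑ a, c a (q w) • ρ (p ⁻¹' {a})) B := by
    rw [integral_comp_simpleFunc _ _ r fun a ↦ c a.1 a.2,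
      integral_comp_simpleFunc B μ q fun b ↦ ∑ a, c a b • ρ (p ⁻¹' {a}),
      Fintype.sum_prod_type_right]
    simp [hr, VectorMeasure.prod_apply]
  rw [h] at h₁
  rw [norm_sub_rev] at h₂
  rw [dist_eq_norm]
  calc _ ≤ _ := norm_sub_le_norm_sub_add_norm_sub _ _ _
    _ ≤ _ := add_le_add h₁ h₂
    _ = ε * (C₁ + C₂) := by simp only [C₁, C₂]; ring
    _ ≤ δ := by
      rw [hε, div_mul_eq_mul_div, div_le_iff₀ (by positivity)]
      nlinarith

/-- Exchanging the factors of a product of vector measures. -/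
theorem prod_flip_eq_map_swap (B : V →L[ℝ] U →L[ℝ] G)
    (ρ : VectorMeasure X V) [IsFiniteMeasure ρ.variation]
    (μ : VectorMeasure Ω U) :
    μ.prod ρ B.flip = (ρ.prod μ B).map Prod.swap := by
  refine VectorMeasure.prod_eq_of_forall_apply_prod fun S T hS hT ↦ ?_
  rw [VectorMeasure.map_apply _ measurable_swap (hS.prod hT), Set.preimage_swap_prod,
    VectorMeasure.prod_apply]
  rfl

/-- Fubini's theorem for the product of vector measures, in the other order. -/
theorem IsUniformLimitOfRectangles.integral_prod_symm [CompleteSpace U] {φ : X × Ω → ℝ}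
    (hφ : IsUniformLimitOfRectangles φ) (B : V →L[ℝ] U →L[ℝ] G)
    (ρ : VectorMeasure X V) [IsFiniteMeasure ρ.variation]
    (μ : VectorMeasure Ω U) [IsFiniteMeasure μ.variation] :
    ∫ᵛ z, φ z ∂•(ρ.prod μ B) = ρ.integral (fun x ↦ ∫ᵛ w, φ (x, w) ∂•μ) B.flip := by
  refine Eq.trans ?_ (hφ.swap.integral_prod B.flip μ ρ)
  rw [prod_flip_eq_map_swap,
    VectorMeasure.integral_map measurable_swap
      (hφ.swap.isUniformLimitOfSimple.integrable _).aestronglyMeasurable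
      (hφ.isUniformLimitOfSimple.integrable _)]
  rfl

end VectorIntegral

theorem mainTheorem10 {X Ω U V : Type*}
    [TopologicalSpace X] [LocallyCompactSpace X] [T2Space X] [MeasurableSpace X] [BorelSpace X]
    [TopologicalSpace Ω] [LocallyCompactSpace Ω] [T2Space Ω] [MeasurableSpace Ω] [BorelSpace Ω]
    [NormedAddCommGroup U] [NormedSpace ℝ U] [CompleteSpace U]
    [NormedAddCommGroup V] [NormedSpace ℝ V] [CompleteSpace V]
    (B : V →L[ℝ] U →L[ℝ] ℝ) (hB : IsDualPairing B) (φ : C₀(X × Ω, ℝ)) :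
    (∀ (μ : RegularVectorMeasure Ω U) (ρ : RegularVectorMeasure X V)
        (f : integralRKBS φ U) (g : adjointIntegralRKBS φ V),
      (f : X → U) = integrateWeights φ μ → (g : Ω → V) = integrateInputs φ ρ →
        IsUniformLimitOfSimple (g : Ω → V) ∧ IsUniformLimitOfSimple (f : X → U) ∧
        (braket B ρ μ).Integrable φ ∧
        rkbsPairing B φ g f = braketIntegral B φ ρ μ ∧
        braketIntegral B φ ρ μ = uniformPairing B μ.1 (g : Ω → V) ∧
        braketIntegral B φ ρ μ = uniformPairing B.flip ρ.1 (f : X → U)) ∧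
    (∀ (μ μ' : RegularVectorMeasure Ω U) (ρ ρ' : RegularVectorMeasure X V),
      integrateWeights φ μ = integrateWeights φ μ' →
      integrateInputs φ ρ = integrateInputs φ ρ' →
        braketIntegral B φ ρ μ = braketIntegral B φ ρ' μ') := by
  have hφ := φ.isUniformLimitOfRectangles
  have hg (ρ : RegularVectorMeasure X V) : IsUniformLimitOfSimple (integrateInputs φ ρ) :=
    hφ.isUniformLimitOfSimple_integral_left ρ.1
  have hf (μ : RegularVectorMeasure Ω U) : IsUniformLimitOfSimple (integrateWeights φ μ) :=
    hφ.swap.isUniformLimitOfSimple_integral_left μ.1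
  have h₁ (μ : RegularVectorMeasure Ω U) (ρ : RegularVectorMeasure X V) :
      braketIntegral B φ ρ μ = uniformPairing B μ.1 (integrateInputs φ ρ) := by
    rw [uniformPairing_eq_integral B μ.1 (hg ρ)]
    exact hφ.integral_prod B ρ.1 μ.1
  have h₂ (μ : RegularVectorMeasure Ω U) (ρ : RegularVectorMeasure X V) :
      braketIntegral B φ ρ μ = uniformPairing B.flip ρ.1 (integrateWeights φ μ) := by
    rw [uniformPairing_eq_integral B.flip ρ.1 (hf μ)]
    exact hφ.integral_prod_symm B ρ.1 μ.1
  have h (μ μ' : RegularVectorMeasure Ω U) (ρ ρ' : RegularVectorMeasure X V)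
      (hμ : integrateWeights φ μ = integrateWeights φ μ')
      (hρ : integrateInputs φ ρ = integrateInputs φ ρ') :
      braketIntegral B φ ρ μ = braketIntegral B φ ρ' μ' := by
    rw [h₁, hρ, ← h₁, h₂, hμ, ← h₂]
  refine ⟨fun μ ρ f g hfμ hgρ ↦ ⟨hgρ ▸ hg ρ, hfμ ▸ hf μ,
    hφ.isUniformLimitOfSimple.integrable _, ?_, hgρ ▸ h₁ μ ρ, hfμ ▸ h₂ μ ρ⟩, h⟩
  exact h _ _ _ _ (f.2.choose_spec.trans hfμ) (g.2.choose_spec.trans hgρ)
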